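/- Let $d\ge 1$ be an integer. A \emph{$d$-fold partition diamond} is a sequence $a_1,a_2,a_3,\dots$ of nonnegative integers, only finitely many of them nonzero, such that for all $n\ge 0$ and $1\le j\le d$ $$a_{n(d+1)+1}\;\ge\; a_{n(d+1)+1+j}\;\ge\; a_{(n+1)(d+1)+1}.$$ The parts $a_{n(d+1)+1}$, $n\ge 0$, are its \emph{links}; the other parts are its \emph{folds}. For every $m\ge 0$ let $s_d(m)$ be the number of $d$-fold partition diamonds whose links sum to $m$, that is, $a_1+a_{d+2}+a_{2(d+1)+1}+\cdots=m$ (Schmidt type counting: the folds are not summed). Then every $s_d(m)$ is finite and, as formal power series in $q$, $$\sum_{m\ge 0}s_d(m)\,q^m\;=\;\prod_{n\ge 1}\frac{E_d(q^n,1)}{(1-q^n)^{d+1}}.$$ Here $E_d(x,y)=\sum_{\tau\in S_d}x^{\operatorname{des}(\tau)}y^{\operatorname{maj}(\tau)}$ is the Euler--Mahonian polynomial, with $\operatorname{Des}(\tau)=\{j:\tau(j)>\tau(j+1)\}$, $\operatorname{des}(\tau)=|\operatorname{Des}(\tau)|$ and $\operatorname{maj}(\tau)=\sum_{j\in\operatorname{Des}(\tau)}j$;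 thus $E_d(x,1)=\sum_{\tau\in S_d}x^{\operatorname{des}(\tau)}$ is the Eulerian polynomial. -/

import Mathlib

/-- A `d`-fold partition diamond: an integer partition (finitely many nonzero parts, padded by
zeros) whose parts are arranged in an infinite chain of diamonds.  The `n`-th diamond starts at
the link `link n`, ends at the link `link (n + 1)`, and has the `d` folds `fold (n, j)` in between;
`link n ≥ fold (n, j) ≥ link (n + 1)`.  In terms of the parts `a₁, a₂, …` this means
`link n = a_{n(d+1)+1}` and `fold (n, j) = a_{n(d+1)+2+j}` for `0 ≤ j < d`. -/
structure PartitionDiamond (d : ℕ) where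
  link : ℕ →₀ ℕ
  fold : ℕ × Fin d →₀ ℕ
  fold_le_link : ∀ (n : ℕ) (j : Fin d), fold (n, j) ≤ link n
  link_le_fold : ∀ (n : ℕ) (j : Fin d), link (n + 1) ≤ fold (n, j)

/-- The Schmidt type weight: the sum of the links `a₁ + a_{d+2} + a_{2(d+1)+1} + ⋯` only. -/
def PartitionDiamond.linkSum {d : ℕ} (D : PartitionDiamond d) : ℕ :=
  D.link.sum fun _ m => m

/-- The generating function of Schmidt type `d`-fold partition diamonds: the coefficient of `q ^ m`
is the number of `d`-fold partition diamonds whose links sum to `m`. -/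
noncomputable def schmidtGenFun (d : ℕ) : PowerSeries ℤ :=
  PowerSeries.mk fun m => (Nat.card {D : PartitionDiamond d // D.linkSum = m} : ℤ)

/-- The descents of `τ`.  Since `Fin d` is `{0, …, d - 1}`, the element `i` stands for the
position `i + 1` of the usual one-based indexing. -/
def descentSet {d : ℕ} (τ : Equiv.Perm (Fin d)) : Finset (Fin d) :=
  {i : Fin d | ∃ h : (i : ℕ) + 1 < d, τ ⟨(i : ℕ) + 1, h⟩ < τ i}

/-- The number of descents. -/
def desStat {d : ℕ} (τ : Equiv.Perm (Fin d)) : ℕ := (descentSet τ).card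

/-- The major index: the sum of the (one-based) descent positions. -/
def majStat {d : ℕ} (τ : Equiv.Perm (Fin d)) : ℕ := ∑ i ∈ descentSet τ, ((i : ℕ) + 1)

/-- The Euler–Mahonian polynomial `E_d(x, y) = ∑_{τ ∈ S_d} x ^ des τ * y ^ maj τ`, where `x` and
`y` are the variables number `0` and `1`. -/
noncomputable def eulerMahonian (d : ℕ) : MvPolynomial (Fin 2) ℤ :=
  ∑ τ : Equiv.Perm (Fin d), MvPolynomial.X 0 ^ desStat τ * MvPolynomial.X 1 ^ majStat τ

/-- The denominators of the product are invertible power series, so that `Ring.inverse` is their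
true inverse. -/
theorem isUnit_one_sub_X_pow_pow (d n : ℕ) :
    IsUnit ((1 - PowerSeries.X ^ (n + 1) : PowerSeries ℤ) ^ (d + 1)) := by
  apply IsUnit.pow
  rw [PowerSeries.isUnit_iff_constantCoeff]
  simp

/- `PowerSeries ℤ` gets the topology of coefficientwise convergence, `ℤ` being discrete. -/
open scoped PowerSeries.WithPiTopology

/-! With the links `l` fixed, the folds of each diamond are independent, so there are `∏ (l n - l (n
+ 1) + 1) ^ d` choices. The gap `l n - l (n + 1)` is the multiplicity of the part `n + 1` in the
conjugate partition, so the count is a sum over partitions of `m` of `∏ (c + 1) ^ d`, with `c`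
running over the multiplicities (`card_linkSum_eq`). Such a weighted sum has an Euler product with
factors `∑ (c + 1) ^ d x ^ c`, `x = q ^ n`. Carlitz's identity turns each factor into `E_d(x, 1) /
(1 - x) ^ (d + 1)`. It rests on Worpitzky's identity, proved by classifying the maps `Fin d → Fin (c
+ 1)` by their sorting permutation (`sortFiberEquiv`). -/

/-- The number of positions `j < i` that are not descents of `τ`. -/
def ascentsBefore {d : ℕ} (τ : Equiv.Perm (Fin d)) (i : ℕ) : ℕ :=
  (Finset.univ.filter fun j : Fin d => (j : ℕ) < i ∧ j ∉ descentSet τ).card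

/-- The number of descents `j < i` of `τ`. -/
def descentsBefore {d : ℕ} (τ : Equiv.Perm (Fin d)) (i : ℕ) : ℕ :=
  (Finset.univ.filter fun j : Fin d => (j : ℕ) < i ∧ j ∈ descentSet τ).card

/-! ### Ascents and descents before a position -/

section Statistics

variable {d : ℕ} (τ : Equiv.Perm (Fin d))

theorem castSucc_mem_descentSet {e : ℕ} (τ : Equiv.Perm (Fin (e + 1))) (i : Fin e) :
    i.castSucc ∈ descentSet τ ↔ τ i.succ < τ i.castSucc := by
  simp [descentSet, Fin.succ]

theorem last_notMem_descentSet {e : ℕ} (τ : Equiv.Perm (Fin (e + 1))) :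
    Fin.last e ∉ descentSet τ := by
  simp [descentSet]

theorem ascentsBefore_add_descentsBefore {i : ℕ} (hi : i ≤ d) :
    ascentsBefore τ i + descentsBefore τ i = i := by
  rw [ascentsBefore, descentsBefore, add_comm, ← Finset.filter_filter, ← Finset.filter_filter,
    Finset.card_filter_add_card_filter_not, Fin.card_filter_val_lt]
  simp [hi]

theorem ascentsBefore_succ (i : Fin d) :
    ascentsBefore τ (i + 1) = ascentsBefore τ i + if i ∈ descentSet τ then 0 else 1 := by
  have h : (Finset.univ.filter fun j : Fin d => (j : ℕ) < i + 1 ∧ j ∉ descentSet τ) =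
      (Finset.univ.filter fun j : Fin d => (j : ℕ) < i ∧ j ∉ descentSet τ) ∪
        if i ∈ descentSet τ then ∅ else {i} := by
    ext j
    have : (j : ℕ) < i + 1 ↔ (j : ℕ) < i ∨ j = i := by rw [Fin.ext_iff]; omega
    split_ifs with hi <;> grind
  rw [ascentsBefore, h, Finset.card_union_of_disjoint]
  · split_ifs <;> simp [ascentsBefore]
  · split_ifs <;> simp

theorem ascentsBefore_mono : Monotone (ascentsBefore τ) := fun i j h => by
  refine Finset.card_le_card fun k => ?_
  simp only [Finset.mem_filter, Finset.mem_univ, true_and]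
  exact fun hk => ⟨hk.1.trans_le h, hk.2⟩

theorem descentsBefore_le (i : ℕ) : descentsBefore τ i ≤ desStat τ :=
  Finset.card_le_card fun k => by simp

theorem ascentsBefore_last_add_desStat {e : ℕ} (τ : Equiv.Perm (Fin (e + 1))) :
    ascentsBefore τ e + desStat τ = e := by
  have h : descentsBefore τ e = desStat τ := by
    rw [descentsBefore, desStat]
    congr 1
    ext j
    simp only [Finset.mem_filter, Finset.mem_univ, true_and, and_iff_right_iff_imp]
    intro hj
    have : j ≠ Fin.last e := fun h => last_notMem_descentSet τ (h ▸ hj)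
    exact Fin.lt_last_iff_ne_last.2 this
  rw [← h, ascentsBefore_add_descentsBefore τ (Nat.le_succ e)]

theorem desStat_le {e : ℕ} (τ : Equiv.Perm (Fin (e + 1))) : desStat τ ≤ e := by
  have := ascentsBefore_last_add_desStat τ
  omega

end Statistics

/-! ### Worpitzky's and Carlitz's identities -/

section Worpitzky

variable {e c : ℕ}

/-- `Tuple.sort` breaks ties by index, so it is the permutation making `(f (τ i), τ i)`
lexicographically increasing. Neighbours suffice to check this, and a tie is forbidden exactly at a
descent of `τ`. -/
theorem eq_sort_iff_castSucc_succ {α : Type*} [LinearOrder α] (f : Fin (e + 1) → α)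
    (τ : Equiv.Perm (Fin (e + 1))) :
    τ = Tuple.sort f ↔ ∀ i : Fin e, f (τ i.castSucc) ≤ f (τ i.succ) ∧
      (i.castSucc ∈ descentSet τ → f (τ i.castSucc) < f (τ i.succ)) := by
  simp only [castSucc_mem_descentSet]
  constructor
  · rintro h i
    obtain ⟨h1, h2⟩ := Tuple.eq_sort_iff.1 h
    have h3 := h1 (Fin.castSucc_lt_succ (i := i)).le
    refine ⟨h3, fun h4 => lt_of_le_of_ne h3 fun h5 => ?_⟩
    exact lt_asymm h4 (h2 _ _ (Fin.castSucc_lt_succ (i := i)) h5)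
  · intro h
    have hm : StrictMono fun i => toLex (f (τ i), τ i) := by
      refine Fin.strictMono_iff_lt_succ.2 fun i => ?_
      obtain ⟨h1, h2⟩ := h i
      rw [Prod.Lex.toLex_lt_toLex]
      rcases h1.lt_or_eq with h3 | h3
      · exact Or.inl h3
      · refine Or.inr ⟨h3, ?_⟩
        have : τ i.castSucc ≠ τ i.succ := fun h => (Fin.castSucc_lt_succ (i := i)).ne (τ.injective h)
        exact lt_of_le_of_ne (not_lt.1 fun h4 => (h2 h4).ne h3) this
    refine Tuple.eq_sort_iff.2 ⟨fun i j hij => ?_, fun i j hij hf => ?_⟩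
    · have := hm.monotone hij
      rw [Prod.Lex.toLex_le_toLex] at this
      exact this.elim le_of_lt fun h => h.1.le
    · have := hm hij
      rw [Prod.Lex.toLex_lt_toLex] at this
      exact this.elim (fun h => absurd hf h.ne) fun h => h.2

theorem strictMono_fin_bounds {e n : ℕ} (h : Fin (e + 1) ↪o Fin n) (i : Fin (e + 1)) :
    (i : ℕ) ≤ h i ∧ (h i : ℕ) + (e - i) < n := by
  constructor
  · induction i using Fin.induction with
    | zero => simp
    | succ i ih =>
      have := h.strictMono (Fin.castSucc_lt_succ (i := i))
      rw [Fin.lt_def] at this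
      simp only [Fin.val_succ, Fin.val_castSucc] at *
      omega
  · induction i using Fin.reverseInduction with
    | last => simp
    | cast i ih =>
      have := h.strictMono (Fin.castSucc_lt_succ (i := i))
      rw [Fin.lt_def] at this
      simp only [Fin.val_succ, Fin.val_castSucc] at *
      omega

/-- Tuples sorted by `τ` become strictly increasing after adding the number of ascents. -/
def sortFiberEquiv (τ : Equiv.Perm (Fin (e + 1))) :
    {f : Fin (e + 1) → Fin (c + 1) // Tuple.sort f = τ} ≃
      (Fin (e + 1) ↪o Fin (c + (e + 1) - desStat τ)) where
  toFun f := OrderEmbedding.ofStrictMono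
    (fun i => ⟨f.1 (τ i) + ascentsBefore τ i, by
      have h1 := (f.1 (τ i)).is_lt
      have h2 := ascentsBefore_mono τ (Fin.is_le i)
      have h3 := ascentsBefore_last_add_desStat τ
      omega⟩)
    (by
      refine Fin.strictMono_iff_lt_succ.2 fun i => ?_
      obtain ⟨h1, h2⟩ := (eq_sort_iff_castSucc_succ f.1 τ).1 f.2.symm i
      have h3 := ascentsBefore_succ τ i.castSucc
      simp only [Fin.lt_def, Fin.le_def, Fin.val_succ, Fin.val_castSucc] at h1 h2 h3 ⊢
      split_ifs at h3 with h
      · have := h2 h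
        omega
      · omega)
  invFun h := ⟨fun i => ⟨h (τ.symm i) - ascentsBefore τ (τ.symm i : Fin (e + 1)), by
      -- At sorted position `k = τ.symm i` the value is at most `c + descentsBefore τ k - desStat τ
      -- ≤ c`.
      obtain ⟨h1, h2⟩ := strictMono_fin_bounds h (τ.symm i)
      have h3 := ascentsBefore_add_descentsBefore τ (τ.symm i).is_lt.le
      have h4 := descentsBefore_le τ (τ.symm i : Fin (e + 1))
      have h5 := desStat_le τ
      omega⟩, by
    refine ((eq_sort_iff_castSucc_succ _ τ).2 fun i => ?_).symm
    have h1 := (strictMono_fin_bounds h i.castSucc).1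
    have h2 := ascentsBefore_add_descentsBefore τ i.castSucc.is_lt.le
    have h3 := ascentsBefore_succ τ i.castSucc
    have h4 := h.strictMono (Fin.castSucc_lt_succ (i := i))
    simp only [Fin.lt_def, Fin.le_def, Fin.val_succ, Fin.val_castSucc,
      Equiv.symm_apply_apply] at h1 h2 h3 h4 ⊢
    split_ifs at h3 with h
    · omega
    · exact ⟨by omega, fun h' => absurd h' h⟩⟩
  left_inv f := by
    ext i
    simp
  right_inv h := by
    ext i
    have h1 := (strictMono_fin_bounds h i).1
    have h2 := ascentsBefore_add_descentsBefore τ i.is_lt.le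
    simp only [OrderEmbedding.coe_ofStrictMono, Equiv.symm_apply_apply]
    omega

theorem card_fin_orderEmb (k n : ℕ) : Nat.card (Fin k ↪o Fin n) = n.choose k := by
  rw [Nat.card_congr Set.powersetCard.ofFinEmbEquiv, Set.powersetCard.card, Nat.card_fin]

/-- Worpitzky's identity. -/
theorem succ_pow_eq_sum_choose (e c : ℕ) :
    (c + 1) ^ (e + 1) =
      ∑ τ : Equiv.Perm (Fin (e + 1)), (c + (e + 1) - desStat τ).choose (e + 1) := by
  calc (c + 1) ^ (e + 1) = Nat.card (Fin (e + 1) → Fin (c + 1)) := by simp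
    _ = Nat.card (Σ τ, {f : Fin (e + 1) → Fin (c + 1) // Tuple.sort f = τ}) :=
      Nat.card_congr (Equiv.sigmaFiberEquiv _).symm
    _ = _ := by
      rw [Nat.card_sigma]
      exact Finset.sum_congr rfl fun τ _ => by
        rw [Nat.card_congr (sortFiberEquiv τ), card_fin_orderEmb]

open PowerSeries in
/-- Carlitz's identity at `y = 1`. -/
theorem mk_succ_pow_mul_one_sub_X_pow (e : ℕ) :
    (mk fun c => ((c : ℤ) + 1) ^ (e + 1)) * (1 - X) ^ (e + 2) =
      ∑ τ : Equiv.Perm (Fin (e + 1)), X ^ desStat τ := by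
  have h : (mk fun c => ((c : ℤ) + 1) ^ (e + 1)) =
      (∑ τ : Equiv.Perm (Fin (e + 1)), X ^ desStat τ) *
        mk fun n => ((e + 1 + n).choose (e + 1) : ℤ) := by
    ext c
    rw [Finset.sum_mul, map_sum, coeff_mk]
    have := succ_pow_eq_sum_choose e c
    zify at this
    rw [this]
    refine Finset.sum_congr rfl fun τ _ => ?_
    have hτ := desStat_le τ
    rw [coeff_X_pow_mul', coeff_mk]
    split_ifs with hc
    · congr 2
      omega
    -- For `c < desStat τ` the upper index drops below `e + 1`.
    · rw [Nat.choose_eq_zero_of_lt (by omega), Nat.cast_zero]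
  rw [h, mul_assoc, mk_add_choose_mul_one_sub_pow_eq_one, mul_one]

end Worpitzky

/-! ### Conjugate partitions -/

section Conjugate

/-- The conjugate of the partition with multiset of parts `s`: the `n`-th entry is the number of
parts larger than `n`. -/
noncomputable def conjugateParts (s : Multiset ℕ) : ℕ →₀ ℕ :=
  Finsupp.onFinset (Finset.range s.sum) (fun n => s.countP (n < ·)) fun n hn => by
    obtain ⟨a, ha, hna⟩ := Multiset.countP_pos.1 (Nat.pos_of_ne_zero hn)
    exact Finset.mem_range.2 (hna.trans_le (Multiset.le_sum_of_mem ha))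

@[simp]
theorem conjugateParts_apply (s : Multiset ℕ) (n : ℕ) :
    conjugateParts s n = s.countP (n < ·) := rfl

theorem conjugateParts_eq_zero {s : Multiset ℕ} {n : ℕ} (hn : s.sum ≤ n) :
    conjugateParts s n = 0 := by
  by_contra h
  have := Finsupp.support_onFinset_subset (Finsupp.mem_support_iff.2 h)
  exact absurd (Finset.mem_range.1 this) hn.not_gt

theorem conjugateParts_apply_eq_add (s : Multiset ℕ) (n : ℕ) :
    conjugateParts s n = conjugateParts s (n + 1) + s.count (n + 1) := by
  induction s using Multiset.induction with
  | empty => simp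
  | cons a s ih =>
    simp only [conjugateParts_apply, Multiset.countP_cons, Multiset.count_cons] at ih ⊢
    split_ifs <;> omega

theorem sum_range_countP_lt {s : Multiset ℕ} {N : ℕ} (hs : ∀ a ∈ s, a ≤ N) :
    ∑ n ∈ Finset.range N, s.countP (n < ·) = s.sum := by
  induction s using Multiset.induction with
  | empty => simp
  | cons a s ih =>
    have ha : ((Finset.range N).filter (· < a)) = Finset.range a := by
      ext n
      have := hs a (Multiset.mem_cons_self a s)
      simp only [Finset.mem_filter, Finset.mem_range]
      omega
    simp only [Multiset.countP_cons, Finset.sum_add_distrib, Multiset.sum_cons]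
    rw [ih fun b hb => hs b (Multiset.mem_cons_of_mem hb), Finset.sum_boole, ha]
    simp [add_comm]

theorem sum_conjugateParts (s : Multiset ℕ) : ((conjugateParts s).sum fun _ m => m) = s.sum := by
  have h : (conjugateParts s).support ⊆ Finset.range s.sum := Finsupp.support_onFinset_subset
  rw [Finsupp.sum_of_support_subset _ h _ (by simp)]
  exact sum_range_countP_lt fun a ha => Multiset.le_sum_of_mem ha

/-- Consecutive differences recover the multiplicities of positive parts; zeros leave no trace, so
they are excluded. -/
theorem eq_of_conjugateParts_eq {s t : Multiset ℕ} (hs : 0 ∉ s) (ht : 0 ∉ t)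
    (h : conjugateParts s = conjugateParts t) : s = t := by
  ext n
  rcases n with _ | n
  · rw [Multiset.count_eq_zero.2 hs, Multiset.count_eq_zero.2 ht]
  · have h1 := conjugateParts_apply_eq_add s n
    rw [h, conjugateParts_apply_eq_add t n] at h1
    omega

theorem Antitone.finsupp_eq_zero_of_sum_le {l : ℕ →₀ ℕ} (hl : Antitone l) {n : ℕ}
    (hn : (l.sum fun _ m => m) ≤ n) : l n = 0 := by
  by_contra h
  have h1 : Finset.range (n + 1) ⊆ l.support := fun i hi => by
    have := hl (Nat.lt_succ_iff.1 (Finset.mem_range.1 hi))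
    exact Finsupp.mem_support_iff.2 (by omega)
  have h2 : ∑ i ∈ Finset.range (n + 1), 1 ≤ l.sum fun _ m => m :=
    (Finset.sum_le_sum_of_subset h1).trans
      (Finset.sum_le_sum fun i hi => Nat.one_le_iff_ne_zero.2 (Finsupp.mem_support_iff.1 hi))
  simp at h2
  omega

/-- Take `l n - l (n + 1)` copies of each part `n + 1`. -/
theorem exists_partition_conjugateParts_eq {l : ℕ →₀ ℕ} (hl : Antitone l) {m : ℕ}
    (hm : (l.sum fun _ k => k) = m) : ∃ p : m.Partition, conjugateParts p.parts = l := by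
  let s : Multiset ℕ := ∑ n ∈ Finset.range m, Multiset.replicate (l n - l (n + 1)) (n + 1)
  have hz (n : ℕ) (hn : m ≤ n) : l n = 0 := hl.finsupp_eq_zero_of_sum_le (hm.trans_le hn)
  have hmem (a : ℕ) (ha : a ∈ s) : 0 < a ∧ a ≤ m := by
    obtain ⟨n, hn, han⟩ := Multiset.mem_sum.1 ha
    have := Multiset.eq_of_mem_replicate han
    have := Finset.mem_range.1 hn
    omega
  have hcount (n : ℕ) (hn : n < m) : s.count (n + 1) = l n - l (n + 1) := by
    simp only [s, Multiset.count_sum', Multiset.count_replicate, add_left_inj]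
    simp [hn]
  have hs : conjugateParts s = l := by
    ext n
    rcases le_or_gt m n with hn | hn
    · rw [hz n hn, conjugateParts_apply, Multiset.countP_eq_zero]
      intro a ha
      have := hmem a ha
      omega
    -- Descend from `m`, where both sides vanish: they have equal drops at each step.
    · induction hn.le using Nat.decreasingInduction with
      | self => exact absurd hn (lt_irrefl _)
      | of_succ k hk ih =>
        have h1 : conjugateParts s (k + 1) = l (k + 1) := by
          rcases Nat.lt_or_ge (k + 1) m with h | h
          · exact ih h
          · rw [hz _ h, conjugateParts_apply, Multiset.countP_eq_zero]
            intro a ha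
            have := hmem a ha
            omega
        have h2 := hl k.le_succ
        rw [conjugateParts_apply_eq_add, h1, hcount k hn]
        simp only [Nat.succ_eq_add_one] at h2
        omega
  exact ⟨⟨s, fun {a} ha => (hmem a ha).1, by rw [← sum_conjugateParts, hs, hm]⟩, hs⟩

end Conjugate

/-! ### Counting diamonds by their links -/

namespace PartitionDiamond

variable {d : ℕ}

@[ext]
theorem ext_link_fold {D E : PartitionDiamond d} (hl : D.link = E.link) (hf : D.fold = E.fold) :
    D = E := by
  cases D
  cases E
  congr

/-- Consecutive links are compared only through a fold, so at least one is needed. -/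
theorem antitone_link (hd : 1 ≤ d) (D : PartitionDiamond d) : Antitone D.link :=
  antitone_nat_of_succ_le fun n => (D.link_le_fold n ⟨0, hd⟩).trans (D.fold_le_link n ⟨0, hd⟩)

/-- With the links fixed, the folds can be chosen independently of each other. -/
noncomputable def foldEquiv (d : ℕ) {l : ℕ →₀ ℕ} (hl : Antitone l) {m : ℕ} (hm : ∀ n, m ≤ n → l n = 0) :
    {D : PartitionDiamond d // D.link = l} ≃
      ((n : Fin m) → Fin d → Fin (l n - l (n + 1) + 1)) where
  toFun D n j := ⟨D.1.fold (n, j) - l (n + 1), by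
    have := D.1.fold_le_link n j
    rw [D.2] at this
    omega⟩
  invFun x := ⟨{
    link := l
    fold := Finsupp.onFinset (Finset.range m ×ˢ Finset.univ)
      (fun a => if h : a.1 < m then l (a.1 + 1) + x ⟨a.1, h⟩ a.2 else 0) fun a ha => by
        by_contra h
        simp at h
        simp [h] at ha
    fold_le_link n j := by
      have := hl n.le_succ
      simp only [Nat.succ_eq_add_one, Finsupp.onFinset_apply] at this ⊢
      split_ifs with h
      · have := (x ⟨n, h⟩ j).is_lt
        simp only at this
        omega
      · exact Nat.zero_le _
    link_le_fold n j := by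
      simp only [Finsupp.onFinset_apply]
      split_ifs with h
      · exact Nat.le_add_right _ _
      · rw [hm (n + 1) (by omega)] }, rfl⟩
  left_inv D := by
    obtain ⟨D, rfl⟩ := D
    refine Subtype.ext (ext_link_fold rfl ?_)
    ext ⟨n, j⟩
    have h1 := D.link_le_fold n j
    have h2 := D.fold_le_link n j
    simp only [Finsupp.onFinset_apply]
    split_ifs with h
    · omega
    · have := hm n (by omega)
      omega
  right_inv x := by
    ext n j
    simp

theorem sum_conjugateParts_partition {m : ℕ} (p : m.Partition) :
    ((conjugateParts p.parts).sum fun _ k => k) = m := by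
  rw [sum_conjugateParts, p.parts_sum]

/-- A diamond is given by the conjugate of its partition of links together with its folds. -/
noncomputable def linkSumEquiv (hd : 1 ≤ d) (m : ℕ) :
    {D : PartitionDiamond d // D.linkSum = m} ≃
      Σ p : m.Partition, {D : PartitionDiamond d // D.link = conjugateParts p.parts} :=
  (Equiv.ofBijective
    (fun x : Σ p : m.Partition, {D : PartitionDiamond d // D.link = conjugateParts p.parts} =>
      (⟨x.2.1, by rw [linkSum, x.2.2, sum_conjugateParts_partition]⟩ :
        {D : PartitionDiamond d // D.linkSum = m}))
    (by
      constructor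
      · rintro ⟨p, D, hD⟩ ⟨p', D', hD'⟩ h
        obtain rfl : D = D' := congrArg Subtype.val h
        obtain rfl : p = p' := Nat.Partition.ext <| eq_of_conjugateParts_eq
          (fun h => (p.parts_pos h).ne rfl) (fun h => (p'.parts_pos h).ne rfl) (hD.symm.trans hD')
        rfl
      · rintro ⟨D, hD⟩
        obtain ⟨p, hp⟩ := exists_partition_conjugateParts_eq (D.antitone_link hd) hD
        exact ⟨⟨p, D, hp.symm⟩, rfl⟩)).symm

/-- The diamonds whose links form the conjugate of `p`, described by their folds. -/
noncomputable def partitionFoldEquiv (d : ℕ) {m : ℕ} (p : m.Partition) :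
    {D : PartitionDiamond d // D.link = conjugateParts p.parts} ≃
      ((n : Fin m) → Fin d →
        Fin (conjugateParts p.parts n - conjugateParts p.parts (n + 1) + 1)) :=
  foldEquiv d
    (antitone_nat_of_succ_le fun n => by rw [conjugateParts_apply_eq_add _ n]; omega)
    fun n hn => conjugateParts_eq_zero (p.parts_sum.trans_le hn)

theorem card_link_eq_conjugateParts (d : ℕ) {m : ℕ} (p : m.Partition) :
    Nat.card {D : PartitionDiamond d // D.link = conjugateParts p.parts} =
      p.parts.toFinsupp.prod fun _ c => (c + 1) ^ d := by
  rw [Nat.card_congr (partitionFoldEquiv d p), Finsupp.prod_of_support_subset _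
    (s := Finset.range (m + 1)) _ _ (by simp), Finset.prod_range_succ', Nat.card_pi]
  -- The factor at index `0` is `1`, since `0` is not a part; the others are shifted to match the
  -- gaps.
  · have h0 : p.parts.count 0 = 0 := Multiset.count_eq_zero.2 fun h => (p.parts_pos h).ne rfl
    rw [← Fin.prod_univ_eq_prod_range (fun n => (p.parts.toFinsupp (n + 1) + 1) ^ d)]
    simp only [Multiset.toFinsupp_apply, h0, zero_add, one_pow, mul_one]
    refine Finset.prod_congr rfl fun n _ => ?_
    rw [Nat.card_fun, Nat.card_fin, Nat.card_fin, conjugateParts_apply_eq_add _ n,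
      Nat.add_sub_cancel_left]
  · intro a ha
    rw [Multiset.toFinsupp_support, Multiset.mem_toFinset] at ha
    exact Finset.mem_range.2 (Nat.lt_succ_of_le (Nat.Partition.le_of_mem_parts ha))

theorem finite_linkSum_eq (hd : 1 ≤ d) (m : ℕ) : {D : PartitionDiamond d | D.linkSum = m}.Finite :=
  have (p : m.Partition) := Finite.of_equiv _ (partitionFoldEquiv d p).symm
  Set.finite_coe_iff.1 (Finite.of_equiv _ (linkSumEquiv hd m).symm)

theorem card_linkSum_eq (hd : 1 ≤ d) (m : ℕ) :
    Nat.card {D : PartitionDiamond d // D.linkSum = m} =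
      ∑ p : m.Partition, p.parts.toFinsupp.prod fun _ c => (c + 1) ^ d := by
  have (p : m.Partition) := Finite.of_equiv _ (partitionFoldEquiv d p).symm
  rw [Nat.card_congr (linkSumEquiv hd m), Nat.card_sigma]
  simp only [card_link_eq_conjugateParts]

end PartitionDiamond

theorem schmidtGenFun_eq_genFun {d : ℕ} (hd : 1 ≤ d) :
    schmidtGenFun d = Nat.Partition.genFun fun _ c => ((c : ℤ) + 1) ^ d := by
  ext m
  rw [schmidtGenFun, PowerSeries.coeff_mk, Nat.Partition.coeff_genFun,
    PartitionDiamond.card_linkSum_eq hd]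
  simp [Finsupp.prod]

/-! ### Factors of the Euler product -/

section Factors
open PowerSeries

theorem aeval_eulerMahonian_one (d : ℕ) (x : PowerSeries ℤ) :
    MvPolynomial.aeval ![x, 1] (eulerMahonian d) =
      ∑ τ : Equiv.Perm (Fin d), x ^ desStat τ := by
  simp [eulerMahonian]

theorem expand_mk_succ_pow (e n : ℕ) :
    expand (n + 1) n.succ_ne_zero (mk fun c => ((c : ℤ) + 1) ^ (e + 1)) =
      MvPolynomial.aeval ![(X ^ (n + 1) : PowerSeries ℤ), 1] (eulerMahonian (e + 1)) *
        Ring.inverse ((1 - X ^ (n + 1) : PowerSeries ℤ) ^ (e + 1 + 1)) := by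
  have h := congrArg (expand (n + 1) n.succ_ne_zero) (mk_succ_pow_mul_one_sub_X_pow e)
  simp only [map_mul, map_pow, map_sub, map_one, map_sum, expand_X] at h
  rw [aeval_eulerMahonian_one, ← h, mul_assoc,
    Ring.mul_inverse_cancel _ (isUnit_one_sub_X_pow_pow (e + 1) n), mul_one]

/-- `Nat.Partition.hasProd_genFun` splits off multiplicity zero as the summand `1`; `hf` lets it
rejoin the series. -/
theorem one_add_tsum_smul_X_pow_eq_expand {R : Type*} [CommRing R] [TopologicalSpace R]
    [T2Space R] (f : ℕ → R) (hf : f 0 = 1) (n : ℕ) :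
    1 + ∑' j, f (j + 1) • (X : PowerSeries R) ^ ((n + 1) * (j + 1)) =
      expand (n + 1) n.succ_ne_zero (mk f) := by
  ext N
  have hs := Nat.Partition.summable_genFun_term (fun _ c => f c) n
  rw [map_add, hs.map_tsum _ (WithPiTopology.continuous_coeff _ _)]
  simp only [map_smul, coeff_X_pow, coeff_one, smul_eq_mul, mul_ite, mul_one, mul_zero]
  by_cases hN : n + 1 ∣ N
  · obtain ⟨c, rfl⟩ := hN
    rw [coeff_expand_mul, coeff_mk]
    rcases c with _ | c
    · simp [hf]
    · rw [tsum_eq_single c]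
      · simp
      · intro b hb
        rw [if_neg]
        simpa using hb.symm
  · rw [coeff_expand_of_not_dvd _ _ _ hN]
    have h0 : N ≠ 0 := fun h => hN (h ▸ dvd_zero _)
    have h1 (j : ℕ) : N ≠ (n + 1) * (j + 1) := fun h => hN (h ▸ dvd_mul_right _ _)
    simp [h0, h1]

end Factors

theorem mainTheorem4 (d : ℕ) (hd : 1 ≤ d) :
    (∀ m : ℕ, {D : PartitionDiamond d | D.linkSum = m}.Finite) ∧
    HasProd
      (fun n : ℕ =>
        MvPolynomial.aeval ![(PowerSeries.X ^ (n + 1) : PowerSeries ℤ), 1] (eulerMahonian d) *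
          Ring.inverse ((1 - PowerSeries.X ^ (n + 1) : PowerSeries ℤ) ^ (d + 1)))
      (schmidtGenFun d) := by
  refine ⟨PartitionDiamond.finite_linkSum_eq hd, ?_⟩
  obtain ⟨e, rfl⟩ := Nat.exists_eq_add_of_le' hd
  rw [schmidtGenFun_eq_genFun hd]
  have h := Nat.Partition.hasProd_genFun fun _ c => ((c : ℤ) + 1) ^ (e + 1)
  rw [funext fun n => (one_add_tsum_smul_X_pow_eq_expand (fun c => ((c : ℤ) + 1) ^ (e + 1))
    (by simp) n).trans (expand_mk_succ_pow e n)] at h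
  exact h
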